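/- Let $n\ge 1$ and $m,p,T\ge 0$ be integers. For a symmetric matrix $N=\begin{bmatrix}N_{11}&N_{12}\\N_{21}&N_{22}\end{bmatrix}$ with $N_{11}\in\mathbb{R}^{q\times q}$, $N_{22}\in\mathbb{R}^{r\times r}$, write $N\in\Pi_{q,r}$ if $N_{22}\preceq 0$, $\ker N_{22}\subseteq\ker N_{12}$ and $N_{11}-N_{12}N_{22}^\dagger N_{21}\succeq 0$, where $\dagger$ is the Moore–Penrose pseudo-inverse. Let $E\in\mathbb{R}^{(2n+m)\times p}$, $\hat\Phi\in\Pi_{p,T}$, and let $X_+,X_-\in\mathbb{R}^{n\times T}$, $U_-\in\mathbb{R}^{m\times T}$ be data, $\mathbf{X}:=[X_+^\top\ \ -X_-^\top\ \ -U_-^\top]^\top$. Say that $\hat\Delta\in\mathbb{R}^{p\times T}$ is an admissible noise if $$\begin{bmatrix}I_p\\ \hat\Delta^\top\end{bmatrix}^\top\hat\Phi\begin{bmatrix}I_p\\ \hat\Delta^\top\end{bmatrix}\succeq 0 .$$ Assume that the data come from some system under data perturbation: there are $A_s\in\mathbb{R}^{n\times n}$, $B_s\in\mathbb{R}^{n\times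 m}$, an admissible noise $\hat\Delta$ and matrices $\Delta_Z,\Delta_X,\Delta_U$ with $[\Delta_Z^\top\ \ -\Delta_X^\top\ \ -\Delta_U^\top]^\top=E\hat\Delta$ and $X_+-\Delta_Z=A_s(X_--\Delta_X)+B_s(U_--\Delta_U)$. Let $\Sigma$ be the set of systems consistent with the data, i.e. of all pairs $(A,B)\in\mathbb{R}^{n\times n}\times\mathbb{R}^{n\times m}$ such that $[I_n\ A\ B]\mathbf{X}=[I_n\ A\ B]E\hat\Delta$ for some admissible noise $\hat\Delta$. The data are called informative for quadratic stabilization if there are $K\in\mathbb{R}^{m\times n}$ and $P\succ 0$ with $P-(A+BK)P(A+BK)^\top\succ 0$ for all $(A,B)\in\Sigma$. Put $N:=[E\ \mathbf{X}]\hat\Phi[E\ \mathbf{X}]^\top$ and consider the linear matrix inequality $$\begin{bmatrix}P-\beta I_n&0&0&0\\0&-P&-L^\top&0\\0&-L&0&L\\0&0&L^\top&P\end{bmatrix}-\begin{bmatrix}N&0\\0&0\end{bmatrix}\succeq 0\qquad(\ast)$$ in the unknowns $P\in\mathbb{R}^{n\times n}$ with $P\succ 0$, $L\in\mathbb{R}^{m\times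 n}$ and $\beta>0$. Then: 1. If $(\ast)$ is feasible, then the data are informative for quadratic stabilization. 2. If $\hat\Phi_{22}\prec 0$ or $\operatorname{im}E_0\subseteq\operatorname{im}E$, where $E_0:=[I_n\ 0]^\top\in\mathbb{R}^{(2n+m)\times n}$, then the data are informative for quadratic stabilization if and only if $(\ast)$ is feasible. 3. If $(P,L,\beta)$ solves $(\ast)$, then $K:=LP^{-1}$ stabilizes all systems in $\Sigma$: for every $(A,B)\in\Sigma$ one has $P-(A+BK)P(A+BK)^\top\succ 0$, and all eigenvalues of $A+BK$ lie in the open unit disc. -/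

import Mathlib

namespace DataPerturbation

open Matrix

/-- The four Penrose equations: `G` is the Moore-Penrose pseudo-inverse of the real matrix `M`. -/
structure IsMoorePenrose {a b : Type*} [Fintype a] [Fintype b]
    (M : Matrix a b ℝ) (G : Matrix b a ℝ) : Prop where
  mul_mul_self : M * G * M = M
  self_mul_mul : G * M * G = G
  left_symm : (M * G)ᵀ = M * G
  right_symm : (G * M)ᵀ = G * M

theorem IsMoorePenrose.unique {a b : Type*} [Fintype a] [Fintype b]
    {M : Matrix a b ℝ} {G H : Matrix b a ℝ}
    (hG : IsMoorePenrose M G) (hH : IsMoorePenrose M H) : G = H := by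
  have e1 : M * G = M * H := by
    calc M * G = (M * G)ᵀ := hG.left_symm.symm
      _ = ((M * H) * (M * G))ᵀ := by
        rw [← Matrix.mul_assoc (M * H) M G, hH.mul_mul_self]
      _ = (M * G) * (M * H) := by rw [transpose_mul, hG.left_symm, hH.left_symm]
      _ = M * H := by rw [← Matrix.mul_assoc (M * G) M H, hG.mul_mul_self]
  have e2 : G * M = H * M := by
    calc G * M = (G * M)ᵀ := hG.right_symm.symm
      _ = ((G * M) * (H * M))ᵀ := by
        rw [Matrix.mul_assoc G M (H * M), ← Matrix.mul_assoc M H M, hH.mul_mul_self]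
      _ = (H * M) * (G * M) := by rw [transpose_mul, hG.right_symm, hH.right_symm]
      _ = H * M := by
        rw [Matrix.mul_assoc H M (G * M), ← Matrix.mul_assoc M G M, hG.mul_mul_self]
  calc G = G * M * G := hG.self_mul_mul.symm
    _ = H * (M * G) := by rw [e2, Matrix.mul_assoc]
    _ = H := by rw [e1, ← Matrix.mul_assoc, hH.self_mul_mul]

theorem exists_isMoorePenrose_of_isHermitian {a : Type*} [Fintype a]
    (M : Matrix a a ℝ) (hM : M.IsHermitian) : ∃ G, IsMoorePenrose M G ∧ Gᵀ = G := by
  classical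
  let U : Matrix a a ℝ := hM.eigenvectorUnitary
  let D : Matrix a a ℝ := diagonal hM.eigenvalues
  let D' : Matrix a a ℝ := diagonal fun i => (hM.eigenvalues i)⁻¹
  have hU : Uᵀ * U = 1 := by
    have h := Unitary.coe_star_mul_self hM.eigenvectorUnitary
    simpa [U, star_eq_conjTranspose] using h
  have hS : M = U * D * Uᵀ := by
    have h := hM.spectral_theorem
    rw [Unitary.conjStarAlgAut_apply] at h
    simpa [U, D, star_eq_conjTranspose, Function.comp_def] using h
  have key : ∀ F K : Matrix a a ℝ, (U * F * Uᵀ) * (U * K * Uᵀ) = U * (F * K) * Uᵀ := by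
    intro F K
    calc (U * F * Uᵀ) * (U * K * Uᵀ) = U * F * (Uᵀ * U) * K * Uᵀ := by
          simp only [Matrix.mul_assoc]
      _ = U * (F * K) * Uᵀ := by rw [hU]; simp only [Matrix.mul_assoc, Matrix.one_mul]
  refine ⟨U * D' * Uᵀ, ⟨?_, ?_, ?_, ?_⟩, ?_⟩
  · rw [hS, key, key]
    congr 2
    simp [D, D', diagonal_mul_diagonal]
  · rw [hS, key, key]
    congr 2
    simp only [D, D', diagonal_mul_diagonal]
    congr 1
    funext i
    by_cases hi : hM.eigenvalues i = 0
    · simp [hi]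
    · field_simp
  · rw [hS, key]
    simp [D, D', diagonal_mul_diagonal, transpose_mul, Matrix.mul_assoc]
  · rw [hS, key]
    simp [D, D', diagonal_mul_diagonal, transpose_mul, Matrix.mul_assoc]
  · simp [D', transpose_mul, Matrix.mul_assoc]

theorem exists_isMoorePenrose {a b : Type*} [Fintype a] [Fintype b]
    (M : Matrix a b ℝ) : ∃ G, IsMoorePenrose M G := by
  classical
  have hs : (Mᵀ * M).IsHermitian := by
    simpa using isHermitian_conjTranspose_mul_self M
  obtain ⟨G, hG, hGs⟩ := exists_isMoorePenrose_of_isHermitian (Mᵀ * M) hs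
  refine ⟨G * Mᵀ, ?_, ?_, ?_, ?_⟩
  · have h0 : Mᵀ * (M * G * Mᵀ * M - M) = 0 := by
      rw [Matrix.mul_sub, sub_eq_zero]
      simpa only [Matrix.mul_assoc] using hG.mul_mul_self
    have h1 : (M * G * Mᵀ * M - M)ᵀ * (M * G * Mᵀ * M - M) = 0 := by
      have h2 : M * G * Mᵀ * M - M = M * (G * (Mᵀ * M)) - M := by
        simp only [Matrix.mul_assoc]
      have h3 : (M * G * Mᵀ * M - M)ᵀ = ((G * (Mᵀ * M))ᵀ - (1 : Matrix b b ℝ)) * Mᵀ := by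
        rw [h2, transpose_sub, transpose_mul, Matrix.sub_mul, Matrix.one_mul]
      rw [h3, Matrix.mul_assoc, h0, Matrix.mul_zero]
    have h4 : M * G * Mᵀ * M - M = 0 := by
      apply conjTranspose_mul_self_eq_zero.mp
      simpa using h1
    simpa only [Matrix.mul_assoc] using sub_eq_zero.mp h4
  · have h := congrArg (fun Y => Y * Mᵀ) hG.self_mul_mul
    simpa only [Matrix.mul_assoc] using h
  · simp only [transpose_mul, transpose_transpose, hGs, Matrix.mul_assoc]
  · simpa only [Matrix.mul_assoc] using hG.right_symm

/-- The Moore-Penrose pseudo-inverse of a real matrix. -/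
noncomputable def pinv {a b : Type*} [Fintype a] [Fintype b] (M : Matrix a b ℝ) : Matrix b a ℝ :=
  Classical.choose (exists_isMoorePenrose M)

theorem pinv_isMoorePenrose {a b : Type*} [Fintype a] [Fintype b] (M : Matrix a b ℝ) :
    IsMoorePenrose M (pinv M) :=
  Classical.choose_spec (exists_isMoorePenrose M)

/-- The generalized Schur complement `N | N₂₂ = N₁₁ - N₁₂ N₂₂† N₂₁` of a block matrix. -/
noncomputable def schurComplement {a b : Type*} [Fintype a] [Fintype b]
    (N : Matrix (a ⊕ b) (a ⊕ b) ℝ) : Matrix a a ℝ :=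
  N.toBlocks₁₁ - N.toBlocks₁₂ * pinv N.toBlocks₂₂ * N.toBlocks₂₁

/-- Membership in the class `Π_{q,r}` of symmetric matrices `N` with
`N₂₂ ⪯ 0`, `ker N₂₂ ⊆ ker N₁₂` and `N | N₂₂ ⪰ 0`. -/
structure IsEllipsoidMatrix {q r : ℕ}
    (N : Matrix (Fin q ⊕ Fin r) (Fin q ⊕ Fin r) ℝ) : Prop where
  symm : N.IsSymm
  neg_semidef : (-N.toBlocks₂₂).PosSemidef
  ker_le : LinearMap.ker N.toBlocks₂₂.mulVecLin ≤ LinearMap.ker N.toBlocks₁₂.mulVecLin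
  schur_semidef : (schurComplement N).PosSemidef

/-- The quadratic matrix inequality `[I; Z]ᵀ N [I; Z] ⪰ 0`. -/
def SatisfiesQMI {a b : Type*} [Fintype a] [Fintype b] [DecidableEq a]
    (N : Matrix (a ⊕ b) (a ⊕ b) ℝ) (Z : Matrix b a ℝ) : Prop :=
  ((fromRows (1 : Matrix a a ℝ) Z)ᵀ * N * fromRows (1 : Matrix a a ℝ) Z).PosSemidef

/-- The data matrix `[X₊; -X₋; -U₋]`. -/
def dataMatrix {n m T : ℕ} (Xp Xm : Matrix (Fin n) (Fin T) ℝ) (Um : Matrix (Fin m) (Fin T) ℝ) :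
    Matrix (Fin n ⊕ (Fin n ⊕ Fin m)) (Fin T) ℝ :=
  fromRows Xp (fromRows (-Xm) (-Um))

/-- The matrix `[I A B]`. -/
def systemRow {n m : ℕ} (A : Matrix (Fin n) (Fin n) ℝ) (B : Matrix (Fin n) (Fin m) ℝ) :
    Matrix (Fin n) (Fin n ⊕ (Fin n ⊕ Fin m)) ℝ :=
  fromCols 1 (fromCols A B)

/-- The set `Σ` of systems `(A, B)` consistent with the data `(X₊, X₋, U₋)`: those for which some
`D` satisfies the noise inequality given by `Φ` together with `[I A B] 𝐗 = [I A B] E D`. -/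
def consistentSystems {n m p T : ℕ}
    (E : Matrix (Fin n ⊕ (Fin n ⊕ Fin m)) (Fin p) ℝ)
    (Φ : Matrix (Fin p ⊕ Fin T) (Fin p ⊕ Fin T) ℝ)
    (Xp Xm : Matrix (Fin n) (Fin T) ℝ) (Um : Matrix (Fin m) (Fin T) ℝ) :
    Set (Matrix (Fin n) (Fin n) ℝ × Matrix (Fin n) (Fin m) ℝ) :=
  {S | ∃ D : Matrix (Fin p) (Fin T) ℝ, SatisfiesQMI Φ Dᵀ ∧
    systemRow S.1 S.2 * dataMatrix Xp Xm Um = systemRow S.1 S.2 * (E * D)}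

/-- The Lyapunov inequality `P - (A + B K) P (A + B K)ᵀ ≻ 0`. -/
def LyapunovInequality {n m : ℕ} (A : Matrix (Fin n) (Fin n) ℝ) (B : Matrix (Fin n) (Fin m) ℝ)
    (K : Matrix (Fin m) (Fin n) ℝ) (P : Matrix (Fin n) (Fin n) ℝ) : Prop :=
  (P - (A + B * K) * P * (A + B * K)ᵀ).PosDef

/-- The data are informative for quadratic stabilization: one gain `K` and one `P ≻ 0` satisfy the
Lyapunov inequality for all systems consistent with the data. -/
def InformativeForQuadraticStabilization {n m p T : ℕ}
    (E : Matrix (Fin n ⊕ (Fin n ⊕ Fin m)) (Fin p) ℝ)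
    (Φ : Matrix (Fin p ⊕ Fin T) (Fin p ⊕ Fin T) ℝ)
    (Xp Xm : Matrix (Fin n) (Fin T) ℝ) (Um : Matrix (Fin m) (Fin T) ℝ) : Prop :=
  ∃ (K : Matrix (Fin m) (Fin n) ℝ) (P : Matrix (Fin n) (Fin n) ℝ), P.PosDef ∧
    ∀ S ∈ consistentSystems E Φ Xp Xm Um, LyapunovInequality S.1 S.2 K P

/-- Asymptotic stability of `x(t+1) = F x(t)`: all complex eigenvalues lie in the open unit disc. -/
def IsSchurStable {n : ℕ} (F : Matrix (Fin n) (Fin n) ℝ) : Prop :=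
  ∀ z ∈ spectrum ℂ (F.map (algebraMap ℝ ℂ)), ‖z‖ < 1

/-- The matrix `N = [E 𝐗] Φ [E 𝐗]ᵀ`. -/
def systemQMIMatrix {n m p T : ℕ}
    (E : Matrix (Fin n ⊕ (Fin n ⊕ Fin m)) (Fin p) ℝ)
    (Φ : Matrix (Fin p ⊕ Fin T) (Fin p ⊕ Fin T) ℝ)
    (Xp Xm : Matrix (Fin n) (Fin T) ℝ) (Um : Matrix (Fin m) (Fin T) ℝ) :
    Matrix (Fin n ⊕ (Fin n ⊕ Fin m)) (Fin n ⊕ (Fin n ⊕ Fin m)) ℝ :=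
  fromCols E (dataMatrix Xp Xm Um) * Φ * (fromCols E (dataMatrix Xp Xm Um))ᵀ

/-- `(P, L, β)` solves the linear matrix inequality
`[P - β I, 0, 0, 0; 0, -P, -Lᵀ, 0; 0, -L, 0, L; 0, 0, Lᵀ, P] - [N, 0; 0, 0] ⪰ 0`
with `P ≻ 0` and `β > 0`. -/
def SolvesLMI {n m : ℕ}
    (N : Matrix (Fin n ⊕ (Fin n ⊕ Fin m)) (Fin n ⊕ (Fin n ⊕ Fin m)) ℝ)
    (P : Matrix (Fin n) (Fin n) ℝ) (L : Matrix (Fin m) (Fin n) ℝ) (β : ℝ) : Prop :=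
  P.PosDef ∧ 0 < β ∧
    (fromBlocks
        (fromBlocks (P - β • (1 : Matrix (Fin n) (Fin n) ℝ)) 0 0 (fromBlocks (-P) (-Lᵀ) (-L) 0))
        (fromRows 0 (fromRows 0 L))
        (fromCols 0 (fromCols 0 Lᵀ))
        P
      - fromBlocks N 0 0 (0 : Matrix (Fin n) (Fin n) ℝ)).PosSemidef

/-- The matrix `E₀ = [I; 0]`. -/
def noiseEmbedding (n m : ℕ) : Matrix (Fin n ⊕ (Fin n ⊕ Fin m)) (Fin n) ℝ :=
  fromRows 1 0

end DataPerturbation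

open DataPerturbation

/-! All conditions are read as inequalities between quadratic forms at vectors `(u, y)`; a system
enters through its graph `y = [A B]ᵀ u`. A Schur complement on the last block `P`, with `L = K P`,
turns the LMI into `β |u|² ≤ P(u) - P([I Kᵀ] y) - N(u, y)` for all `u, y` (`solvesLMI_iff_quad`).
Consistent systems satisfy `N(u, [A B]ᵀ u) ≥ 0`, so a solution of the LMI gives the Lyapunov
inequality, and the eigenvalue bound follows from it.

The converse has two ingredients. Under either extra hypothesis, every pair obeying the quadratic
inequality of `N` is consistent: complete the square in `Φ` and recover the noise by Douglas
factorization (`IsEllipsoidMatrix.exists_satisfiesQMI`). So the Lyapunov inequality holds on the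
whole solution set, and the matrix S-lemma `exists_matrix_multiplier` applies.

That S-lemma assumes no sign of `N₂₂`. Uniform Lyapunov decrease forces `H = [I Kᵀ]` to vanish on
directions of unbounded solutions; as `H` is onto, this yields `N₂₂ ⪯ 0` and `ker N₂₂ ⊆ ker N₁₂`.
Every `(u, y)` with `u ≠ 0` and `N(u, y) ≥ 0` lies on the graph of a solution, up to directions
killed by `H`, so the implication between matrix inequalities becomes one between vectors, where the
strict S-lemma `exists_multiplier_pos` gives a multiplier. It is positive and is scaled to one. -/

section

open Matrix

/-- The quadratic form `xᵀ M x`. -/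
def quad {ι : Type*} [Fintype ι] (M : Matrix ι ι ℝ) (x : ι → ℝ) : ℝ := x ⬝ᵥ M *ᵥ x

/-! ### Calculus of real quadratic forms. -/

section quad
variable {ι κ : Type*} [Fintype ι] [Fintype κ]

theorem quad_smul (M : Matrix ι ι ℝ) (c : ℝ) (x : ι → ℝ) :
    quad M (c • x) = c ^ 2 * quad M x := by
  simp only [quad, mulVec_smul, smul_dotProduct, dotProduct_smul, smul_eq_mul]
  ring

theorem quad_add_smul (M : Matrix ι ι ℝ) (x y : ι → ℝ) (t : ℝ) :
    quad M (x + t • y) = quad M x + t * (x ⬝ᵥ M *ᵥ y + y ⬝ᵥ M *ᵥ x) + t ^ 2 * quad M y := by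
  simp only [quad, mulVec_add, mulVec_smul, add_dotProduct, dotProduct_add, smul_dotProduct,
    dotProduct_smul, smul_eq_mul]
  ring

theorem quad_zero (M : Matrix ι ι ℝ) : quad M 0 = 0 := by simp [quad]

theorem quad_sub_matrix (M N : Matrix ι ι ℝ) (x : ι → ℝ) :
    quad (M - N) x = quad M x - quad N x := by
  simp [quad, sub_mulVec, dotProduct_sub]

theorem quad_add_matrix (M N : Matrix ι ι ℝ) (x : ι → ℝ) :
    quad (M + N) x = quad M x + quad N x := by
  simp [quad, add_mulVec, dotProduct_add]

theorem quad_smul_matrix (c : ℝ) (M : Matrix ι ι ℝ) (x : ι → ℝ) :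
    quad (c • M) x = c * quad M x := by
  simp [quad, smul_mulVec, dotProduct_smul]

theorem quad_neg_matrix (M : Matrix ι ι ℝ) (x : ι → ℝ) : quad (-M) x = -quad M x := by
  simp [quad, neg_mulVec, dotProduct_neg]

theorem quad_one [DecidableEq ι] (x : ι → ℝ) : quad (1 : Matrix ι ι ℝ) x = x ⬝ᵥ x := by
  simp [quad]

theorem quad_conj (M : Matrix ι ι ℝ) (A : Matrix ι κ ℝ) (x : κ → ℝ) :
    quad (Aᵀ * M * A) x = quad M (A *ᵥ x) := by
  simp only [quad]
  rw [Matrix.mul_assoc, ← mulVec_mulVec, dotProduct_mulVec x, vecMul_transpose, ← mulVec_mulVec]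

theorem quad_conj' (M : Matrix ι ι ℝ) (A : Matrix κ ι ℝ) (x : κ → ℝ) :
    quad (A * M * Aᵀ) x = quad M (Aᵀ *ᵥ x) := by
  simpa using quad_conj M Aᵀ x

theorem continuous_quad (M : Matrix ι ι ℝ) : Continuous (quad M) := by
  unfold quad
  fun_prop

theorem posSemidef_iff_quad {M : Matrix ι ι ℝ} : M.PosSemidef ↔ M.IsSymm ∧ ∀ x, 0 ≤ quad M x := by
  rw [posSemidef_iff_dotProduct_mulVec]
  simp [quad, IsHermitian, IsSymm]

theorem posDef_iff_quad {M : Matrix ι ι ℝ} :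
    M.PosDef ↔ M.IsSymm ∧ ∀ x, x ≠ 0 → 0 < quad M x := by
  rw [posDef_iff_dotProduct_mulVec]
  simp [quad, IsHermitian, IsSymm]

theorem dotProduct_self_pos {x : ι → ℝ} (hx : x ≠ 0) : 0 < x ⬝ᵥ x := by
  have := dotProduct_star_self_pos_iff.2 hx
  simpa using this

theorem dotProduct_self_nonneg' (x : ι → ℝ) : 0 ≤ x ⬝ᵥ x :=
  Finset.sum_nonneg fun _ _ => mul_self_nonneg _

theorem symm_dotProduct_mulVec {M : Matrix ι ι ℝ} (hM : M.IsSymm) (x y : ι → ℝ) :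
    x ⬝ᵥ M *ᵥ y = y ⬝ᵥ M *ᵥ x := by
  rw [dotProduct_mulVec, ← mulVec_transpose, hM.eq, dotProduct_comm]

theorem quad_add_smul_of_isSymm {M : Matrix ι ι ℝ} (hM : M.IsSymm) (x y : ι → ℝ) (t : ℝ) :
    quad M (x + t • y) = quad M x + 2 * t * (x ⬝ᵥ M *ᵥ y) + t ^ 2 * quad M y := by
  rw [quad_add_smul, symm_dotProduct_mulVec hM y x]
  ring

end quad

/-! ### The S-lemma for two quadratic forms. -/

section SLemma
variable {ι : Type*} [Fintype ι]

/-- A homogeneous continuous function of degree two dominates a multiple of the squared norm,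
which can be taken positive if the function is positive off the origin. -/
theorem exists_le_of_homogeneous {h : (ι → ℝ) → ℝ} (hc : Continuous h)
    (hh : ∀ c : ℝ, ∀ x, h (c • x) = c ^ 2 * h x) :
    ∃ δ, ((∀ x, x ≠ 0 → 0 < h x) → 0 < δ) ∧ ∀ x, δ * (x ⬝ᵥ x) ≤ h x := by
  rcases isEmpty_or_nonempty ι with hι | hι
  · refine ⟨1, fun _ => one_pos, fun x => ?_⟩
    obtain rfl : x = 0 := Subsingleton.elim _ _
    have := hh 0 0
    simp at this
    simp [this]
  have hK : IsCompact (Metric.sphere (0 : ι → ℝ) 1) := isCompact_sphere _ _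
  have hne : (Metric.sphere (0 : ι → ℝ) 1).Nonempty := NormedSpace.sphere_nonempty.2 zero_le_one
  have hx0 : ∀ x ∈ Metric.sphere (0 : ι → ℝ) 1, x ≠ 0 := by
    rintro x hx rfl
    simp at hx
  -- The quotient is homogeneous of degree zero, so its minimum on the compact sup-norm sphere
  -- bounds it everywhere off the origin.
  obtain ⟨x₀, hx₀, hmin⟩ := hK.exists_isMinOn (f := fun x => h x / (x ⬝ᵥ x)) hne
    (ContinuousOn.div hc.continuousOn (by fun_prop)
      fun x hx => (dotProduct_self_pos (hx0 x hx)).ne')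
  refine ⟨_, fun hpos => div_pos (hpos x₀ (hx0 _ hx₀)) (dotProduct_self_pos (hx0 _ hx₀)),
    fun x => ?_⟩
  by_cases hx : x = 0
  · subst hx
    have := hh 0 0
    simp at this
    simp [this]
  have hn : ‖x‖ ≠ 0 := norm_ne_zero_iff.2 hx
  have hy : ‖x‖⁻¹ • x ∈ Metric.sphere (0 : ι → ℝ) 1 := by
    simp [norm_smul, hn]
  have := hmin hy
  simp only [Set.mem_ofPred_eq, hh, smul_dotProduct, dotProduct_smul, smul_eq_mul] at this
  rw [← le_div_iff₀ (dotProduct_self_pos hx)]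
  refine this.trans_eq ?_
  have := (dotProduct_self_pos hx).ne'
  field_simp

/-- The implication says exactly that `max (M, -N)` is positive off the origin; compactness makes
this uniform. -/
theorem exists_le_max_of_implication {M N : Matrix ι ι ℝ}
    (h : ∀ x, x ≠ 0 → 0 ≤ quad N x → 0 < quad M x) :
    ∃ δ, 0 < δ ∧ ∀ x, δ * (x ⬝ᵥ x) ≤ max (quad M x) (-quad N x) := by
  obtain ⟨δ, hδ, hδx⟩ := exists_le_of_homogeneous (h := fun x => max (quad M x) (-quad N x))
    ((continuous_quad M).max (continuous_quad N).neg) fun c x => by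
      simp only [quad_smul]
      rw [mul_max_of_nonneg _ _ (sq_nonneg c), mul_neg]
  refine ⟨δ, hδ fun x hx => ?_, hδx⟩
  rcases le_or_gt 0 (quad N x) with h0 | h0
  · exact lt_max_of_lt_left (h x hx h0)
  · exact lt_max_of_lt_right (neg_pos.2 h0)

/-- On the line `x + t y` the form `N` has one positive and one negative root, and `M` is positive
at both. Subtracting the multiple `l` of `N` that makes the constant term of `M` vanish leaves `t (b
+ t a)`, which is positive at roots of both signs only if `a > 0`. -/
theorem ratio_le_of_implication {M N : Matrix ι ι ℝ}
    (h : ∀ x, x ≠ 0 → 0 ≤ quad N x → 0 < quad M x) {x y : ι → ℝ}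
    (hx : 0 < quad N x) (hy : quad N y < 0) :
    quad M y / quad N y ≤ quad M x / quad N x := by
  set c := x ⬝ᵥ N *ᵥ y + y ⬝ᵥ N *ᵥ x with hc
  set d := x ⬝ᵥ M *ᵥ y + y ⬝ᵥ M *ᵥ x with hd
  set l := quad M x / quad N x with hl
  have hyn := hy.ne
  have hlx : quad M x = l * quad N x := by rw [hl]; field_simp
  set s := Real.sqrt (c ^ 2 - 4 * quad N y * quad N x) with hs
  have hcs : c ^ 2 < c ^ 2 - 4 * quad N y * quad N x := by nlinarith [mul_pos hx (neg_pos.2 hy)]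
  have hss : s ^ 2 = c ^ 2 - 4 * quad N y * quad N x := Real.sq_sqrt (by nlinarith [sq_nonneg c])
  have habs : |c| < s := by
    rw [hs, ← Real.sqrt_sq_eq_abs]
    exact Real.sqrt_lt_sqrt (sq_nonneg c) hcs
  obtain ⟨hc1, hc2⟩ := abs_lt.1 habs
  have root : ∀ t, quad N x + t * c + t ^ 2 * quad N y = 0 →
      0 < t * (d - l * c) + t ^ 2 * (quad M y - l * quad N y) := by
    intro t ht
    have e : quad N (x + t • y) = 0 := by rw [quad_add_smul, ← hc]; exact ht
    have hne : x + t • y ≠ 0 := by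
      intro h0
      have hxy : x = (-t) • y := by rw [neg_smul]; exact eq_neg_of_add_eq_zero_left h0
      have := hx
      rw [hxy, quad_smul] at this
      nlinarith [sq_nonneg (-t)]
    have := h _ hne e.ge
    rw [quad_add_smul, ← hd, hlx] at this
    have e2 : l * (quad N x + t * c + t ^ 2 * quad N y) = 0 := by rw [ht, mul_zero]
    linarith
  have r1 := root ((-c - s) / (2 * quad N y)) (by field_simp; nlinarith)
  have r2 := root ((-c + s) / (2 * quad N y)) (by field_simp; nlinarith)
  have p1 : 0 < (-c - s) / (2 * quad N y) := div_pos_of_neg_of_neg (by linarith) (by linarith)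
  have p2 : (-c + s) / (2 * quad N y) < 0 := div_neg_of_pos_of_neg (by linarith) (by linarith)
  set t1 := (-c - s) / (2 * quad N y)
  set t2 := (-c + s) / (2 * quad N y)
  set b := d - l * c
  set a := quad M y - l * quad N y with ha
  have q1 : 0 < b + t1 * a := by
    by_contra hcon
    nlinarith [mul_nonneg p1.le (sub_nonneg.2 (not_lt.1 hcon))]
  have q2 : b + t2 * a < 0 := by
    by_contra hcon
    nlinarith [mul_nonneg (neg_pos.2 p2).le (not_lt.1 hcon)]
  have hapos : 0 < a := by
    by_contra hcon
    nlinarith [mul_nonneg (sub_pos.2 (p2.trans p1)).le (sub_nonneg.2 (not_lt.1 hcon))]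
  rw [div_le_iff_of_neg hy]
  linarith

/-- The S-lemma under a strict implication, with a nonstrict conclusion. -/
theorem exists_multiplier_nonneg {M N : Matrix ι ι ℝ}
    (h : ∀ x, x ≠ 0 → 0 ≤ quad N x → 0 < quad M x) :
    ∃ α, 0 ≤ α ∧ ∀ x, 0 ≤ quad M x - α * quad N x := by
  by_cases hex : ∃ x, 0 < quad N x
  · obtain ⟨x₀, hx₀⟩ := hex
    have hne : ∀ x, quad N x ≠ 0 → x ≠ 0 := by
      rintro x hx rfl
      exact hx (quad_zero N)
    obtain ⟨α, hα1, hα2⟩ := exists_between_of_forall_le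
      (s := insert 0 {r | ∃ y, quad N y < 0 ∧ r = quad M y / quad N y})
      (t := {r | ∃ x, 0 < quad N x ∧ r = quad M x / quad N x})
      ⟨0, Set.mem_insert _ _⟩ ⟨_, x₀, hx₀, rfl⟩ (by
        rintro _ (rfl | ⟨y, hy, rfl⟩) _ ⟨x, hx, rfl⟩
        · exact (div_pos (h x (hne x hx.ne') hx.le) hx).le
        · exact ratio_le_of_implication h hx hy)
    refine ⟨α, hα1 (Set.mem_insert _ _), fun x => ?_⟩
    rcases lt_trichotomy (quad N x) 0 with hx | hx | hx
    · have := hα1 (Set.mem_insert_of_mem _ ⟨x, hx, rfl⟩)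
      rw [div_le_iff_of_neg hx] at this
      linarith
    · by_cases h0 : x = 0
      · simp [h0, quad_zero]
      · rw [hx, mul_zero, sub_zero]
        exact (h x h0 hx.ge).le
    · have := hα2 ⟨x, hx, rfl⟩
      rw [le_div_iff₀ hx] at this
      linarith
  · push Not at hex
    obtain ⟨δ, hδ, hδx⟩ := exists_le_max_of_implication h
    obtain ⟨γ, hγ, hγx⟩ : ∃ γ, 0 ≤ γ ∧ ∀ x, -γ * (x ⬝ᵥ x) ≤ quad M x := by
      obtain ⟨F, -, hFx⟩ := exists_le_of_homogeneous (continuous_quad M) (quad_smul M)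
      refine ⟨|F|, abs_nonneg F, fun x => le_trans ?_ (hFx x)⟩
      exact mul_le_mul_of_nonneg_right (neg_abs_le F) (dotProduct_self_nonneg' x)
    -- Here `N ≤ 0` everywhere. Where `M` is not already large, `-N ≥ δ |x|²`, and the factor `γ /
    -- δ` lets it absorb the lower bound `-γ |x|²` of `M`.
    refine ⟨γ / δ, div_nonneg hγ hδ.le, fun x => ?_⟩
    have hq := hex x
    rcases le_max_iff.1 (hδx x) with h1 | h1
    · have h2 : 0 ≤ γ / δ * -quad N x := mul_nonneg (div_nonneg hγ hδ.le) (by linarith)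
      have h3 := mul_nonneg hδ.le (dotProduct_self_nonneg' x)
      linarith
    · have h2 := mul_le_mul_of_nonneg_left h1 (div_nonneg hγ hδ.le)
      have h3 : γ / δ * (δ * (x ⬝ᵥ x)) = γ * (x ⬝ᵥ x) := by field_simp
      have := hγx x
      linarith

/-- The strict S-lemma for two real quadratic forms. -/
theorem exists_multiplier_pos [DecidableEq ι] {M N : Matrix ι ι ℝ}
    (h : ∀ x, x ≠ 0 → 0 ≤ quad N x → 0 < quad M x) :
    ∃ α ε, 0 ≤ α ∧ 0 < ε ∧ ∀ x, ε * (x ⬝ᵥ x) ≤ quad M x - α * quad N x := by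
  obtain ⟨δ, hδ, hδx⟩ := exists_le_max_of_implication h
  -- The uniform margin `δ` leaves the implication intact when both forms are shifted by `δ / 2`;
  -- the shift of `M` becomes the strict gap.
  obtain ⟨α, hα, hαx⟩ := exists_multiplier_nonneg (M := M - (δ / 2) • 1) (N := N + (δ / 2) • 1)
    (fun x hx hx2 => by
      rw [quad_add_matrix, quad_smul_matrix, quad_one] at hx2
      rw [quad_sub_matrix, quad_smul_matrix, quad_one]
      have := mul_pos hδ (dotProduct_self_pos hx)
      rcases le_max_iff.1 (hδx x) with h1 | h1 <;> linarith)
  refine ⟨α, δ / 2, hα, by linarith, fun x => ?_⟩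
  have := hαx x
  rw [quad_add_matrix, quad_smul_matrix, quad_one, quad_sub_matrix, quad_smul_matrix,
    quad_one] at this
  have h2 := mul_nonneg hα (mul_nonneg hδ.le (dotProduct_self_nonneg' x))
  linarith

end SLemma

/-! ### From graphs of solutions to the matrix S-lemma. -/

section MatrixSLemma
variable {a b : Type*}

theorem sumElim_add_smul (u v : a → ℝ) (y z : b → ℝ) (t : ℝ) :
    Sum.elim u y + t • Sum.elim v z = Sum.elim (u + t • v) (y + t • z) := by
  ext i
  cases i <;> simp

/-- The pairing of graph vectors with a fixed `q` is linear in `v`; its representing vector `w`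
serves as the row factor of rank-one perturbations of `Z₀`. -/
theorem exists_graph_dotProduct [Fintype a] [Fintype b] (Z : Matrix b a ℝ) (q : a ⊕ b → ℝ) :
    ∃ w : a → ℝ, ∀ v, Sum.elim v (Z *ᵥ v) ⬝ᵥ q = w ⬝ᵥ v := by
  refine ⟨q ∘ Sum.inl + Zᵀ *ᵥ (q ∘ Sum.inr), fun v => ?_⟩
  rw [← Sum.elim_comp_inl_inr q, sumElim_dotProduct_sumElim, add_dotProduct, mulVec_transpose,
    ← dotProduct_mulVec]
  simp only [Sum.elim_comp_inl, Sum.elim_comp_inr]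
  rw [dotProduct_comm v, dotProduct_comm (Z *ᵥ v)]

theorem add_vecMulVec_mulVec [Fintype a] (Z : Matrix b a ℝ) (d : b → ℝ) (w u : a → ℝ) :
    (Z + vecMulVec d w) *ᵥ u = Z *ᵥ u + (w ⬝ᵥ u) • d := by
  rw [add_mulVec, vecMulVec_mulVec]
  simp

variable [Fintype a] [Fintype b]
variable {N : Matrix (a ⊕ b) (a ⊕ b) ℝ} {P : Matrix a a ℝ} {H : Matrix a b ℝ} {Z₀ : Matrix b a ℝ}

/-- A direction along which the quadratic inequality has unbounded solutions is annihilated by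
`H`. -/
theorem mulVec_eq_zero_of_quad_nonneg [Nonempty a] (hN : N.IsSymm) (hP : P.PosDef)
    (h0 : ∀ u, 0 ≤ quad N (Sum.elim u (Z₀ *ᵥ u)))
    (hQ : ∀ Z : Matrix b a ℝ, (∀ u, 0 ≤ quad N (Sum.elim u (Z *ᵥ u))) →
      ∀ u, u ≠ 0 → quad P (H *ᵥ (Z *ᵥ u)) < quad P u)
    {y : b → ℝ} (hy : 0 ≤ quad N (Sum.elim (0 : a → ℝ) y)) : H *ᵥ y = 0 := by
  obtain ⟨w', hw'⟩ := exists_graph_dotProduct Z₀ (N *ᵥ Sum.elim (0 : a → ℝ) y)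
  -- With this `w` the cross term produced by adding `t y wᵀ` to `Z₀` is nonnegative, so the whole
  -- ray `t ≥ 0` consists of solutions.
  obtain ⟨w, hw, hww⟩ : ∃ w : a → ℝ, w ≠ 0 ∧ ∀ v, 0 ≤ (w ⬝ᵥ v) * (w' ⬝ᵥ v) := by
    by_cases h : w' = 0
    · exact ⟨fun _ => 1, fun h1 => one_ne_zero (congrFun h1 (Classical.arbitrary a)), by simp [h]⟩
    · exact ⟨w', h, fun v => mul_self_nonneg _⟩
  have hray : ∀ t, 0 ≤ t →
      quad P (H *ᵥ (Z₀ *ᵥ w) + (t * (w ⬝ᵥ w)) • H *ᵥ y) < quad P w := by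
    intro t ht
    have := hQ (Z₀ + vecMulVec (t • y) w) (fun u => by
      have e : Sum.elim u ((Z₀ + vecMulVec (t • y) w) *ᵥ u)
          = Sum.elim u (Z₀ *ᵥ u) + (t * (w ⬝ᵥ u)) • Sum.elim (0 : a → ℝ) y := by
        rw [sumElim_add_smul, add_vecMulVec_mulVec, smul_zero, add_zero, smul_smul, mul_comm t]
      rw [e, quad_add_smul_of_isSymm hN, hw']
      have h1 := h0 u
      have h2 := mul_nonneg ht (hww u)
      have h3 := mul_nonneg (sq_nonneg (t * (w ⬝ᵥ u))) hy
      linarith) w hw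
    rwa [add_vecMulVec_mulVec, mulVec_add, smul_smul, mulVec_smul, mul_comm _ t] at this
  by_contra hne
  have hPq := posDef_iff_quad.1 hP
  have hc2 := hPq.2 _ hne
  have hp := hPq.2 _ hw
  have hs := dotProduct_self_pos hw
  set c := (H *ᵥ (Z₀ *ᵥ w)) ⬝ᵥ P *ᵥ (H *ᵥ y) + (H *ᵥ y) ⬝ᵥ P *ᵥ (H *ᵥ (Z₀ *ᵥ w)) with hc
  -- Large enough for the quadratic term in `τ` to dominate both the cross term and the fixed bound
  -- `P(w)`.
  set τ := (|c| + quad P w) / quad P (H *ᵥ y) + 1 with hτ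
  have hτ1 : 1 ≤ τ := by
    have : 0 ≤ (|c| + quad P w) / quad P (H *ᵥ y) := by positivity
    linarith
  have hτ2 : τ * quad P (H *ᵥ y) = |c| + quad P w + quad P (H *ᵥ y) := by
    rw [hτ]; field_simp
  have := hray (τ / (w ⬝ᵥ w)) (by positivity)
  rw [div_mul_cancel₀ _ hs.ne', quad_add_smul, ← hc] at this
  have hc0 := (posSemidef_iff_quad.1 hP.posSemidef).2 (H *ᵥ (Z₀ *ᵥ w))
  have h4 : 0 ≤ τ * (|c| + c) := mul_nonneg (by linarith) (by linarith [neg_abs_le c])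
  have h5 : 0 ≤ (τ - 1) * (quad P w + quad P (H *ᵥ y)) :=
    mul_nonneg (by linarith) (by linarith)
  have h6 : τ ^ 2 * quad P (H *ᵥ y) = τ * (|c| + quad P w + quad P (H *ᵥ y)) := by
    rw [← hτ2]; ring
  linarith

/-- Positivity at `y` would persist at `y + ε z` for small `ε > 0`. Then `H` kills both points,
hence `z`, although `z` was chosen with `H z ≠ 0`. -/
theorem quad_sumElim_zero_nonpos [Nonempty a] (hN : N.IsSymm) (hP : P.PosDef)
    (hH : Function.Surjective H.mulVec)
    (h0 : ∀ u, 0 ≤ quad N (Sum.elim u (Z₀ *ᵥ u)))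
    (hQ : ∀ Z : Matrix b a ℝ, (∀ u, 0 ≤ quad N (Sum.elim u (Z *ᵥ u))) →
      ∀ u, u ≠ 0 → quad P (H *ᵥ (Z *ᵥ u)) < quad P u)
    (y : b → ℝ) : quad N (Sum.elim (0 : a → ℝ) y) ≤ 0 := by
  by_contra hcon
  push Not at hcon
  obtain ⟨z, hz⟩ := hH fun _ => 1
  have hcont : Continuous fun ε : ℝ =>
      quad N (Sum.elim (0 : a → ℝ) y + ε • Sum.elim (0 : a → ℝ) z) :=
    (continuous_quad N).comp (by fun_prop)
  have hev : ∀ᶠ ε : ℝ in nhds 0, 0 < quad N (Sum.elim (0 : a → ℝ) y + ε • Sum.elim (0 : a → ℝ) z) :=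
    hcont.continuousAt.eventually (lt_mem_nhds (by simpa using hcon))
  obtain ⟨ε, hε, hε0⟩ := ((hev.filter_mono nhdsWithin_le_nhds).and
    (self_mem_nhdsWithin (s := Set.Ioi (0 : ℝ)))).exists
  have h1 := mulVec_eq_zero_of_quad_nonneg hN hP h0 hQ hcon.le
  rw [sumElim_add_smul, smul_zero, add_zero] at hε
  have h2 := mulVec_eq_zero_of_quad_nonneg hN hP h0 hQ hε.le
  rw [mulVec_add, h1, zero_add, mulVec_smul] at h2
  have h3 := (smul_eq_zero.1 h2).resolve_left (ne_of_gt hε0)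
  have := congrFun (hz.symm.trans h3) (Classical.arbitrary a)
  simp at this

/-- A vector satisfying the quadratic inequality of `N` lies on the graph of a solution of the
matrix inequality, up to directions annihilated by `H`. -/
theorem quad_lt_of_quad_nonneg [Nonempty a] (hN : N.IsSymm) (hP : P.PosDef)
    (hH : Function.Surjective H.mulVec)
    (h0 : ∀ u, 0 ≤ quad N (Sum.elim u (Z₀ *ᵥ u)))
    (hQ : ∀ Z : Matrix b a ℝ, (∀ u, 0 ≤ quad N (Sum.elim u (Z *ᵥ u))) →
      ∀ u, u ≠ 0 → quad P (H *ᵥ (Z *ᵥ u)) < quad P u)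
    {u : a → ℝ} (hu : u ≠ 0) {y : b → ℝ} (huy : 0 ≤ quad N (Sum.elim u y)) :
    quad P (H *ᵥ y) < quad P u := by
  obtain ⟨d, rfl⟩ : ∃ d, y = Z₀ *ᵥ u + d := ⟨y - Z₀ *ᵥ u, by simp⟩
  have e0 : Sum.elim u (Z₀ *ᵥ u + d) = Sum.elim u (Z₀ *ᵥ u) + (1 : ℝ) • Sum.elim (0 : a → ℝ) d := by
    rw [sumElim_add_smul]; simp
  have hA := h0 u
  have hC := quad_sumElim_zero_nonpos hN hP hH h0 hQ d
  have hexp := quad_add_smul_of_isSymm hN (Sum.elim u (Z₀ *ᵥ u)) (Sum.elim (0 : a → ℝ) d) 1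
  rw [← e0] at hexp
  obtain ⟨w, hw⟩ := exists_graph_dotProduct Z₀ (N *ᵥ Sum.elim u (Z₀ *ᵥ u + d))
  have hwu : w ⬝ᵥ u = quad N (Sum.elim u (Z₀ *ᵥ u))
      + Sum.elim u (Z₀ *ᵥ u) ⬝ᵥ N *ᵥ Sum.elim (0 : a → ℝ) d := by
    rw [← hw, e0, mulVec_add, one_smul, dotProduct_add]
    rfl
  rcases le_or_gt (w ⬝ᵥ u) 0 with h | h
  -- Since `N(u, y) = 2 (w ⬝ u) - N(u, Z₀ u) + N(0, d)`, the signs squeeze `N(0, d)` to zero; then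
  -- `H d = 0` and `Z₀` itself suffices.
  · have hc0 : quad N (Sum.elim (0 : a → ℝ) d) = 0 := by linarith
    rw [mulVec_add, mulVec_eq_zero_of_quad_nonneg hN hP h0 hQ hc0.ge, add_zero]
    exact hQ Z₀ h0 u hu
  -- The perturbed map sends `u` to `y`. Its graph over `v` splits into a graph vector of `Z₀` and a
  -- multiple of `(u, y)`, which are `N`-orthogonal by the choice of `s`.
  · have hZu : (Z₀ + vecMulVec ((w ⬝ᵥ u)⁻¹ • d) w) *ᵥ u = Z₀ *ᵥ u + d := by
      rw [add_vecMulVec_mulVec, smul_smul, mul_inv_cancel₀ h.ne', one_smul]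
    rw [← hZu]
    refine hQ _ (fun v => ?_) u hu
    set s := w ⬝ᵥ v / w ⬝ᵥ u with hs
    have hv : Sum.elim v ((Z₀ + vecMulVec ((w ⬝ᵥ u)⁻¹ • d) w) *ᵥ v)
        = Sum.elim (v - s • u) (Z₀ *ᵥ (v - s • u)) + s • Sum.elim u (Z₀ *ᵥ u + d) := by
      rw [sumElim_add_smul, add_vecMulVec_mulVec, smul_smul, sub_add_cancel, ← div_eq_mul_inv,
        mulVec_sub, mulVec_smul, smul_add, ← hs]
      congr 1
      abel
    have hwv : w ⬝ᵥ (v - s • u) = 0 := by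
      rw [dotProduct_sub, dotProduct_smul, hs, smul_eq_mul, div_mul_cancel₀ _ h.ne', sub_self]
    rw [hv, quad_add_smul_of_isSymm hN, hw, hwv]
    have h1 := h0 (v - s • u)
    have h2 := mul_nonneg (sq_nonneg s) huy
    linarith

/-- If `w = N₁₂ k` were nonzero, take `H y = w`. Moving `y` along `k` does not change `H y`, as `H k
= 0`, but changes `N(w, y)` linearly with slope `2 |w|²`; at its zero the Lyapunov bound reads `P(w)
< P(w)`. -/
theorem mulVec_sumElim_zero_eq_zero [Nonempty a] (hN : N.IsSymm) (hP : P.PosDef)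
    (hH : Function.Surjective H.mulVec)
    (h0 : ∀ u, 0 ≤ quad N (Sum.elim u (Z₀ *ᵥ u)))
    (hQ : ∀ Z : Matrix b a ℝ, (∀ u, 0 ≤ quad N (Sum.elim u (Z *ᵥ u))) →
      ∀ u, u ≠ 0 → quad P (H *ᵥ (Z *ᵥ u)) < quad P u)
    {k : b → ℝ} (hk : N.toBlocks₂₂ *ᵥ k = 0) : N *ᵥ Sum.elim (0 : a → ℝ) k = 0 := by
  have hNk : N *ᵥ Sum.elim (0 : a → ℝ) k = Sum.elim (N.toBlocks₁₂ *ᵥ k) 0 := by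
    conv_lhs => rw [← fromBlocks_toBlocks N, fromBlocks_mulVec]
    simp [hk]
  have hq : quad N (Sum.elim (0 : a → ℝ) k) = 0 := by
    rw [quad, hNk, sumElim_dotProduct_sumElim]
    simp
  have hHk := mulVec_eq_zero_of_quad_nonneg hN hP h0 hQ hq.ge
  set w := N.toBlocks₁₂ *ᵥ k with hw
  by_cases hw0 : w = 0
  · rw [hNk, hw0]
    ext i
    cases i <;> rfl
  exfalso
  obtain ⟨y, hy⟩ := hH w
  have hs := dotProduct_self_pos hw0
  set s := -(quad N (Sum.elim w y)) / (2 * (w ⬝ᵥ w)) with hsdef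
  have := quad_lt_of_quad_nonneg hN hP hH h0 hQ hw0 (y := y + s • k) (by
    have e : Sum.elim w (y + s • k) = Sum.elim w y + s • Sum.elim (0 : a → ℝ) k := by
      rw [sumElim_add_smul]; simp
    rw [e, quad_add_smul_of_isSymm hN, hq, hNk, sumElim_dotProduct_sumElim, dotProduct_zero,
      add_zero, mul_zero, add_zero, hsdef]
    field_simp
    simp)
  rw [mulVec_add, mulVec_smul, hHk, smul_zero, add_zero] at this
  exact this.ne (congrArg _ hy)

/-- The matrix S-lemma for the Lyapunov form `P - Zᵀ Hᵀ P H Z`, without definiteness assumptions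
on the lower right block of `N`. -/
theorem exists_matrix_multiplier [Nonempty a] [DecidableEq a] [DecidableEq b]
    (hN : N.IsSymm) (hP : P.PosDef)
    (hH : Function.Surjective H.mulVec)
    (h0 : ∀ u, 0 ≤ quad N (Sum.elim u (Z₀ *ᵥ u)))
    (hQ : ∀ Z : Matrix b a ℝ, (∀ u, 0 ≤ quad N (Sum.elim u (Z *ᵥ u))) →
      ∀ u, u ≠ 0 → quad P (H *ᵥ (Z *ᵥ u)) < quad P u) :
    ∃ α β, 0 < α ∧ 0 < β ∧ ∀ u y,
      β * (u ⬝ᵥ u) ≤ quad P u - quad P (H *ᵥ y) - α * quad N (Sum.elim u y) := by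
  set R := pinv N.toBlocks₂₂ * N.toBlocks₂₂ with hR
  have hNR : N.toBlocks₂₂ * R = N.toBlocks₂₂ := by
    rw [hR, ← Matrix.mul_assoc]
    exact (pinv_isMoorePenrose _).mul_mul_self
  have hRR : R * R = R := by
    conv_lhs => rw [hR, Matrix.mul_assoc, hNR]
  -- `R` is a projection with the kernel of `N₂₂`. The penalty `|y - R y|²` restores strict
  -- positivity on that kernel, where `H` vanishes; it disappears again on evaluation at `R y`.
  set F := fromBlocks P 0 0 ((1 - R)ᵀ * 1 * (1 - R) - Hᵀ * P * H) with hF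
  have hFq : ∀ u y, quad F (Sum.elim u y)
      = quad P u + ((y - R *ᵥ y) ⬝ᵥ (y - R *ᵥ y) - quad P (H *ᵥ y)) := by
    intro u y
    have e : quad F (Sum.elim u y)
        = quad P u + quad ((1 - R)ᵀ * 1 * (1 - R) - Hᵀ * P * H) y := by
      simp [quad, hF, fromBlocks_mulVec, sumElim_dotProduct_sumElim]
    rw [e, quad_sub_matrix, quad_conj, quad_conj, quad_one, sub_mulVec, one_mulVec]
  have h22 : ∀ y, quad N (Sum.elim (0 : a → ℝ) y) = quad N.toBlocks₂₂ y := by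
    intro y
    conv_lhs => rw [quad, ← fromBlocks_toBlocks N, fromBlocks_mulVec, sumElim_dotProduct_sumElim]
    simp [quad]
  have h22neg : (-N.toBlocks₂₂).PosSemidef := by
    refine posSemidef_iff_quad.2 ⟨?_, fun y => ?_⟩
    · exact IsSymm.ext fun i j => by simp [toBlocks₂₂, hN.apply]
    · rw [quad_neg_matrix, ← h22]
      linarith [quad_sumElim_zero_nonpos hN hP hH h0 hQ y]
  obtain ⟨α, ε, hα, hε, h⟩ := exists_multiplier_pos (M := F) (N := N) (by
    intro x hx hxN
    obtain ⟨u, y, rfl⟩ : ∃ u y, x = Sum.elim u y := ⟨_, _, (Sum.elim_comp_inl_inr x).symm⟩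
    rw [hFq]
    by_cases hu : u = 0
    · subst hu
      have hle := quad_sumElim_zero_nonpos hN hP hH h0 hQ y
      have hz : N.toBlocks₂₂ *ᵥ y = 0 := by
        have := (h22neg.dotProduct_mulVec_zero_iff y).1 (by
          have e : star y ⬝ᵥ -N.toBlocks₂₂ *ᵥ y = quad (-N.toBlocks₂₂) y := rfl
          rw [e, quad_neg_matrix, ← h22]
          linarith)
        simpa [neg_mulVec] using this
      have hRy : R *ᵥ y = 0 := by rw [hR, ← mulVec_mulVec, hz, mulVec_zero]
      have hy : y ≠ 0 := by
        rintro rfl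
        apply hx
        ext i
        cases i <;> rfl
      rw [mulVec_eq_zero_of_quad_nonneg hN hP h0 hQ hxN, hRy]
      simpa [quad_zero] using dotProduct_self_pos hy
    · have h1 := quad_lt_of_quad_nonneg hN hP hH h0 hQ hu hxN
      have h2 := dotProduct_self_nonneg' (y - R *ᵥ y)
      linarith)
  have key : ∀ u y,
      ε * (u ⬝ᵥ u) ≤ quad P u - quad P (H *ᵥ y) - α * quad N (Sum.elim u y) := by
    intro u y
    have hk : N.toBlocks₂₂ *ᵥ (y - R *ᵥ y) = 0 := by
      rw [mulVec_sub, mulVec_mulVec, hNR, sub_self]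
    have hNk := mulVec_sumElim_zero_eq_zero hN hP hH h0 hQ hk
    have hqk : quad N (Sum.elim (0 : a → ℝ) (y - R *ᵥ y)) = 0 := by rw [quad, hNk, dotProduct_zero]
    have hHk := mulVec_eq_zero_of_quad_nonneg hN hP h0 hQ hqk.ge
    have hHy : H *ᵥ (R *ᵥ y) = H *ᵥ y := by
      rw [mulVec_sub, sub_eq_zero] at hHk
      exact hHk.symm
    have hNy : quad N (Sum.elim u y) = quad N (Sum.elim u (R *ᵥ y)) := by
      have e : Sum.elim u y
          = Sum.elim u (R *ᵥ y) + (1 : ℝ) • Sum.elim (0 : a → ℝ) (y - R *ᵥ y) := by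
        rw [sumElim_add_smul]; simp
      rw [e, quad_add_smul_of_isSymm hN, hNk, hqk]
      simp
    have := h (Sum.elim u (R *ᵥ y))
    rw [hFq, mulVec_mulVec, hRR, hHy, ← hNy, sumElim_dotProduct_sumElim, sub_self,
      dotProduct_zero, zero_sub] at this
    have h3 := mul_nonneg hε.le (dotProduct_self_nonneg' (R *ᵥ y))
    linarith
  refine ⟨α, ε, lt_of_le_of_ne hα ?_, hε, key⟩
  rintro rfl
  -- With `α = 0` and `u = 0` the bound would give `P(H z) ≤ 0` for some `H z ≠ 0`.
  obtain ⟨z, hz⟩ := hH fun _ => 1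
  have hz' : H *ᵥ z = fun _ => 1 := hz
  have h1 : (fun _ : a => (1 : ℝ)) ≠ 0 := fun h1 =>
    one_ne_zero (congrFun h1 (Classical.arbitrary a))
  have h2 := key 0 z
  have h3 := (posDef_iff_quad.1 hP).2 _ h1
  rw [hz', quad_zero] at h2
  simp only [dotProduct_zero, mul_zero, zero_mul] at h2
  linarith

end MatrixSLemma

/-! ### Square-root and contraction factorizations. -/

section Factorization
variable {a b c : Type*} [Fintype a] [Fintype b] [Fintype c]

open scoped MatrixOrder in
theorem exists_eq_mul_transpose_of_posSemidef {M : Matrix a a ℝ} (hM : M.PosSemidef) :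
    ∃ F : Matrix a a ℝ, M = F * Fᵀ := by
  classical
  obtain ⟨B, hB⟩ := CStarAlgebra.nonneg_iff_eq_star_mul_self.mp hM.nonneg
  exact ⟨Bᵀ, by simpa [star_eq_conjTranspose] using hB⟩

theorem quad_mul_transpose (F : Matrix a b ℝ) (x : a → ℝ) :
    quad (F * Fᵀ) x = (Fᵀ *ᵥ x) ⬝ᵥ (Fᵀ *ᵥ x) := by
  rw [quad, ← mulVec_mulVec, dotProduct_mulVec, ← mulVec_transpose]

theorem dotProduct_self_mulVec_le {R : Matrix a a ℝ} (hs : Rᵀ = R) (hR : R * R = R)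
    (x : a → ℝ) : (R *ᵥ x) ⬝ᵥ (R *ᵥ x) ≤ x ⬝ᵥ x := by
  have h1 : (R *ᵥ x) ⬝ᵥ (R *ᵥ x) = x ⬝ᵥ (R *ᵥ x) := by
    rw [dotProduct_mulVec, ← mulVec_transpose, hs, mulVec_mulVec, hR, dotProduct_comm]
  have h2 := dotProduct_self_nonneg' (x - R *ᵥ x)
  rw [sub_dotProduct, dotProduct_sub, dotProduct_sub, h1, dotProduct_comm (R *ᵥ x) x] at h2
  linarith

/-- Douglas' factorization lemma for real matrices. -/
theorem exists_contraction_factor {A : Matrix a c ℝ} {B : Matrix a b ℝ}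
    (h : ∀ x, (Aᵀ *ᵥ x) ⬝ᵥ (Aᵀ *ᵥ x) ≤ (Bᵀ *ᵥ x) ⬝ᵥ (Bᵀ *ᵥ x)) :
    ∃ C : Matrix b c ℝ, B * C = A ∧ ∀ x, (Cᵀ *ᵥ x) ⬝ᵥ (Cᵀ *ᵥ x) ≤ x ⬝ᵥ x := by
  classical
  have hG := pinv_isMoorePenrose B
  set G := pinv B
  -- The bound makes `Aᵀ` vanish on `ker Bᵀ`, which contains the range of `(1 - B G)ᵀ`;
  -- contractivity reduces to that of the orthogonal projection `G B`.
  refine ⟨G * A, ?_, fun x => ?_⟩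
  · have hX : (A - B * (G * A))ᵀ = 0 := by
      refine Matrix.toLin'.injective (LinearMap.ext fun x => ?_)
      simp only [toLin'_apply, map_zero, LinearMap.zero_apply]
      have e : ∀ d : Type _, ∀ [Fintype d], ∀ T : Matrix a d ℝ,
          (T - B * (G * T))ᵀ *ᵥ x = Tᵀ *ᵥ ((1 - B * G)ᵀ *ᵥ x) := by
        intro d _ T
        rw [mulVec_mulVec, ← transpose_mul, Matrix.sub_mul, Matrix.one_mul, Matrix.mul_assoc]
      have h1 := h ((1 - B * G)ᵀ *ᵥ x)
      have h2 : Bᵀ *ᵥ ((1 - B * G)ᵀ *ᵥ x) = 0 := by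
        rw [mulVec_mulVec, ← transpose_mul, Matrix.sub_mul, Matrix.one_mul, hG.mul_mul_self,
          sub_self, transpose_zero, zero_mulVec]
      rw [h2, dotProduct_zero] at h1
      rw [e]
      by_contra hne
      exact absurd (dotProduct_self_pos hne) (not_lt.2 h1)
    have := congrArg transpose hX
    rw [transpose_transpose, transpose_zero, sub_eq_zero] at this
    exact this.symm
  · rw [transpose_mul, ← mulVec_mulVec]
    refine (h _).trans ?_
    rw [mulVec_mulVec, ← transpose_mul, hG.right_symm]
    refine dotProduct_self_mulVec_le hG.right_symm ?_ x
    rw [← Matrix.mul_assoc, hG.self_mul_mul]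

end Factorization

/-! ### Recovering an admissible noise. -/

section Realization
variable {q r : ℕ} {κ : Type*} [Fintype κ]

theorem quad_sumElim {a b : Type*} [Fintype a] [Fintype b] {N : Matrix (a ⊕ b) (a ⊕ b) ℝ}
    (hN : N.IsSymm) (u : a → ℝ) (y : b → ℝ) :
    quad N (Sum.elim u y)
      = quad N.toBlocks₁₁ u + 2 * (u ⬝ᵥ N.toBlocks₁₂ *ᵥ y) + quad N.toBlocks₂₂ y := by
  have h21 : N.toBlocks₂₁ = N.toBlocks₁₂ᵀ := by
    ext i j
    exact hN.apply _ _
  conv_lhs => rw [quad, ← fromBlocks_toBlocks N, fromBlocks_mulVec, sumElim_dotProduct_sumElim]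
  simp only [Sum.elim_comp_inl, Sum.elim_comp_inr, dotProduct_add, h21, mulVec_transpose]
  rw [dotProduct_comm y (u ᵥ* _), ← dotProduct_mulVec, quad, quad]
  ring

theorem satisfiesQMI_iff_quad {a b : Type*} [Fintype a] [Fintype b] [DecidableEq a]
    {N : Matrix (a ⊕ b) (a ⊕ b) ℝ} (hN : N.IsSymm) (Z : Matrix b a ℝ) :
    SatisfiesQMI N Z ↔ ∀ u, 0 ≤ quad N (Sum.elim u (Z *ᵥ u)) := by
  rw [SatisfiesQMI, posSemidef_iff_quad]
  have e : ∀ u, fromRows (1 : Matrix a a ℝ) Z *ᵥ u = Sum.elim u (Z *ᵥ u) := by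
    intro u
    rw [fromRows_mulVec, one_mulVec]
  simp only [quad_conj, e]
  refine and_iff_right ?_
  rw [IsSymm, transpose_mul, transpose_mul, transpose_transpose, hN.eq, Matrix.mul_assoc]

theorem DataPerturbation.IsEllipsoidMatrix.toBlocks₁₂_mul_pinv_mul
    {Φ : Matrix (Fin q ⊕ Fin r) (Fin q ⊕ Fin r) ℝ} (hΦ : IsEllipsoidMatrix Φ) :
    Φ.toBlocks₁₂ * pinv Φ.toBlocks₂₂ * Φ.toBlocks₂₂ = Φ.toBlocks₁₂ := by
  have h : Φ.toBlocks₁₂ * (1 - pinv Φ.toBlocks₂₂ * Φ.toBlocks₂₂) = 0 := by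
    refine Matrix.toLin'.injective (LinearMap.ext fun x => ?_)
    simp only [toLin'_apply, map_zero, LinearMap.zero_apply]
    rw [← mulVec_mulVec]
    refine hΦ.ker_le (?_ : _ = _)
    rw [mulVecLin_apply, mulVec_mulVec, Matrix.mul_sub, Matrix.mul_one, ← Matrix.mul_assoc,
      (pinv_isMoorePenrose _).mul_mul_self, sub_self, zero_mulVec]
  rw [Matrix.mul_sub, Matrix.mul_one, sub_eq_zero, ← Matrix.mul_assoc] at h
  exact h.symm

/-- Completion of squares for an ellipsoid matrix. -/
theorem DataPerturbation.IsEllipsoidMatrix.quad_eq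
    {Φ : Matrix (Fin q ⊕ Fin r) (Fin q ⊕ Fin r) ℝ} (hΦ : IsEllipsoidMatrix Φ)
    (u : Fin q → ℝ) (y : Fin r → ℝ) :
    quad Φ (Sum.elim u y) = quad (schurComplement Φ) u
      + quad Φ.toBlocks₂₂ (y + (Φ.toBlocks₁₂ * pinv Φ.toBlocks₂₂)ᵀ *ᵥ u) := by
  set W := Φ.toBlocks₁₂ * pinv Φ.toBlocks₂₂ with hW
  have hW2 : W * Φ.toBlocks₂₂ = Φ.toBlocks₁₂ := hΦ.toBlocks₁₂_mul_pinv_mul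
  clear_value W
  have h22 : Φ.toBlocks₂₂.IsSymm := by
    ext i j
    exact hΦ.symm.apply _ _
  have h21 : Φ.toBlocks₂₁ = Φ.toBlocks₁₂ᵀ := by
    ext i j
    exact hΦ.symm.apply _ _
  have hS : schurComplement Φ = Φ.toBlocks₁₁ - W * Φ.toBlocks₂₂ * Wᵀ := by
    have h : Φ.toBlocks₂₂ * Wᵀ = Φ.toBlocks₂₁ := by
      rw [h21, ← hW2, transpose_mul, h22.eq]
    rw [schurComplement, ← hW, Matrix.mul_assoc W, h]
  have hc : y ⬝ᵥ Φ.toBlocks₂₂ *ᵥ (Wᵀ *ᵥ u) = u ⬝ᵥ Φ.toBlocks₁₂ *ᵥ y := by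
    rw [symm_dotProduct_mulVec h22, ← hW2, ← mulVec_mulVec, dotProduct_mulVec u,
      mulVec_transpose]
  have := quad_add_smul_of_isSymm h22 y (Wᵀ *ᵥ u) 1
  rw [one_smul] at this
  rw [this, hc, hS, quad_sub_matrix, quad_conj', quad_sumElim hΦ.symm]
  ring

/-- A solution `Y` of the lifted inequality comes from an admissible noise. -/
theorem DataPerturbation.IsEllipsoidMatrix.exists_satisfiesQMI
    {Φ : Matrix (Fin q ⊕ Fin r) (Fin q ⊕ Fin r) ℝ} (hΦ : IsEllipsoidMatrix Φ)
    {M : Matrix κ (Fin q) ℝ} {Y : Matrix κ (Fin r) ℝ}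
    (hMY : ∀ x, 0 ≤ quad Φ (Sum.elim (Mᵀ *ᵥ x) (Yᵀ *ᵥ x)))
    (hM : (-Φ.toBlocks₂₂).PosDef ∨ ∀ V : Matrix κ (Fin r) ℝ,
      ∃ H : Matrix (Fin q) (Fin r) ℝ, M * H = V) :
    ∃ D : Matrix (Fin q) (Fin r) ℝ, SatisfiesQMI Φ Dᵀ ∧ Y = M * D := by
  set W := Φ.toBlocks₁₂ * pinv Φ.toBlocks₂₂ with hW
  obtain ⟨F, hF⟩ := exists_eq_mul_transpose_of_posSemidef hΦ.schur_semidef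
  obtain ⟨Q, hQ⟩ := exists_eq_mul_transpose_of_posSemidef hΦ.neg_semidef
  have h22 : ∀ y, quad Φ.toBlocks₂₂ y = -((Qᵀ *ᵥ y) ⬝ᵥ (Qᵀ *ᵥ y)) := by
    intro y
    rw [← quad_mul_transpose, ← hQ, quad_neg_matrix, neg_neg]
  set V := Y + M * W with hV
  have hVx : ∀ x, Vᵀ *ᵥ x = Yᵀ *ᵥ x + Wᵀ *ᵥ (Mᵀ *ᵥ x) := by
    intro x
    rw [hV, transpose_add, add_mulVec, transpose_mul, mulVec_mulVec]
  -- After completing the square, the hypothesis is `|(V Q)ᵀ x| ≤ |(M F)ᵀ x|`.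
  obtain ⟨C, hC, hCx⟩ := exists_contraction_factor (A := V * Q) (B := M * F) (by
    intro x
    have := hMY x
    rw [hΦ.quad_eq, ← hVx, h22, hF, quad_mul_transpose] at this
    rw [transpose_mul, transpose_mul, ← mulVec_mulVec, ← mulVec_mulVec]
    linarith)
  have hG := pinv_isMoorePenrose Q
  set G := pinv Q
  -- The noise inequality sees only `D Q`, so the part of `V` off the range of `Q` must be matched
  -- separately: it is absent when `Φ₂₂ ≺ 0`, and otherwise the solvability of `M H = V` supplies
  -- it.
  obtain ⟨H, hH⟩ : ∃ H : Matrix (Fin q) (Fin r) ℝ, M * H * (1 - Q * G) = V * (1 - Q * G) := by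
    rcases hM with hM | hM
    · refine ⟨0, ?_⟩
      have h0 : (1 - Q * G) * (-Φ.toBlocks₂₂) = 0 := by
        rw [hQ, ← Matrix.mul_assoc, Matrix.sub_mul, Matrix.one_mul, hG.mul_mul_self, sub_self,
          Matrix.zero_mul]
      have h1 : 1 - Q * G = 0 := by
        have := congrArg (· * (-Φ.toBlocks₂₂)⁻¹) h0
        simpa only [Matrix.zero_mul, Matrix.mul_nonsing_inv_cancel_right _ _
          ((isUnit_iff_isUnit_det _).1 hM.isUnit)] using this
      rw [h1, Matrix.mul_zero, Matrix.mul_zero]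
    · obtain ⟨H, hH⟩ := hM V
      exact ⟨H, by rw [hH]⟩
  set D := F * C * G + H * (1 - Q * G) with hD
  have hDQ : D * Q = F * (C * (G * Q)) := by
    rw [hD, Matrix.add_mul, Matrix.mul_assoc H, Matrix.sub_mul, Matrix.one_mul, hG.mul_mul_self,
      sub_self, Matrix.mul_zero, add_zero]
    simp only [Matrix.mul_assoc]
  have hMD : M * D = V := by
    rw [hD, Matrix.mul_add, ← Matrix.mul_assoc, ← Matrix.mul_assoc, hC, ← Matrix.mul_assoc, hH,
      Matrix.mul_sub, Matrix.mul_one, ← Matrix.mul_assoc]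
    abel
  refine ⟨D - W, ?_, ?_⟩
  · rw [satisfiesQMI_iff_quad hΦ.symm]
    intro u
    rw [hΦ.quad_eq, h22, hF, quad_mul_transpose, transpose_sub, sub_mulVec, sub_add_cancel,
      mulVec_mulVec, ← transpose_mul, hDQ]
    have e : (F * (C * (G * Q)))ᵀ *ᵥ u = (G * Q) *ᵥ (Cᵀ *ᵥ (Fᵀ *ᵥ u)) := by
      rw [transpose_mul, transpose_mul, hG.right_symm, mulVec_mulVec, mulVec_mulVec]
    rw [e]
    have h1 := dotProduct_self_mulVec_le hG.right_symm
      (by rw [← Matrix.mul_assoc, hG.self_mul_mul]) (Cᵀ *ᵥ (Fᵀ *ᵥ u))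
    have h2 := hCx (Fᵀ *ᵥ u)
    linarith
  · rw [Matrix.mul_sub, hMD, hV, add_sub_cancel_right]

end Realization

/-! ### Consistent systems, Lyapunov stability and the LMI. -/

section Systems
variable {n m p T : ℕ}

/-- The matrix `[I Kᵀ]`. -/
def gainRow (K : Matrix (Fin m) (Fin n) ℝ) : Matrix (Fin n) (Fin n ⊕ Fin m) ℝ :=
  fromCols 1 Kᵀ

theorem gainRow_surjective (K : Matrix (Fin m) (Fin n) ℝ) :
    Function.Surjective (gainRow K).mulVec := by
  intro w
  refine ⟨Sum.elim w 0, ?_⟩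
  simp [gainRow, fromCols_mulVec]

theorem gainRow_mulVec_transpose (A : Matrix (Fin n) (Fin n) ℝ) (B : Matrix (Fin n) (Fin m) ℝ)
    (K : Matrix (Fin m) (Fin n) ℝ) (u : Fin n → ℝ) :
    gainRow K *ᵥ ((fromCols A B)ᵀ *ᵥ u) = (A + B * K)ᵀ *ᵥ u := by
  rw [gainRow, mulVec_mulVec, transpose_fromCols, fromCols_mul_fromRows, Matrix.one_mul,
    transpose_add, transpose_mul]

theorem lyapunovInequality_iff_quad {P : Matrix (Fin n) (Fin n) ℝ} (hP : P.PosDef)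
    (A : Matrix (Fin n) (Fin n) ℝ) (B : Matrix (Fin n) (Fin m) ℝ)
    (K : Matrix (Fin m) (Fin n) ℝ) :
    LyapunovInequality A B K P ↔
      ∀ u, u ≠ 0 → quad P (gainRow K *ᵥ ((fromCols A B)ᵀ *ᵥ u)) < quad P u := by
  have hs := (posDef_iff_quad.1 hP).1
  rw [LyapunovInequality, posDef_iff_quad]
  simp only [quad_sub_matrix, quad_conj', sub_pos, gainRow_mulVec_transpose]
  refine and_iff_right ?_
  rw [IsSymm, transpose_sub, hs.eq, transpose_mul, transpose_mul, transpose_transpose, hs.eq,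
    Matrix.mul_assoc]

/-- The real and imaginary parts of an eigenvector of `Fᵀ`. -/
theorem exists_real_eigenpair {F : Matrix (Fin n) (Fin n) ℝ} {z : ℂ}
    (hz : z ∈ spectrum ℂ (F.map (algebraMap ℝ ℂ))) :
    ∃ x y : Fin n → ℝ, (x ≠ 0 ∨ y ≠ 0) ∧ Fᵀ *ᵥ x = z.re • x - z.im • y ∧
      Fᵀ *ᵥ y = z.re • y + z.im • x := by
  rw [spectrum.mem_iff, isUnit_iff_isUnit_det, isUnit_iff_ne_zero, not_not,
    ← det_transpose, ← exists_mulVec_eq_zero_iff] at hz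
  obtain ⟨v, hv, hv0⟩ := hz
  have hcoord : ∀ i, ∑ j, (F j i : ℂ) * v j = z * v i := by
    intro i
    have h1 : (F.map (algebraMap ℝ ℂ))ᵀ *ᵥ v = z • v := by
      rw [transpose_sub, sub_mulVec, sub_eq_zero, algebraMap_eq_diagonal, diagonal_transpose,
        Pi.algebraMap_def, Algebra.algebraMap_self_apply] at hv0
      rw [← hv0]
      ext i
      simp [mulVec_diagonal]
    simpa [mulVec, dotProduct] using congrFun h1 i
  refine ⟨fun i => (v i).re, fun i => (v i).im, ?_, ?_, ?_⟩
  · by_contra hcon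
    push Not at hcon
    exact hv (funext fun i => Complex.ext (congrFun hcon.1 i) (congrFun hcon.2 i))
  · ext i
    simpa [mulVec, dotProduct] using congrArg Complex.re (hcoord i)
  · ext i
    have := congrArg Complex.im (hcoord i)
    simp only [Complex.im_sum, Complex.mul_im] at this
    simpa [mulVec, dotProduct] using this

/-- Lyapunov's criterion. -/
theorem isSchurStable_of_quad_lt {P F : Matrix (Fin n) (Fin n) ℝ} (hP : P.PosDef)
    (h : ∀ u, u ≠ 0 → quad P (Fᵀ *ᵥ u) < quad P u) : IsSchurStable F := by
  intro z hz
  obtain ⟨x, y, hxy, hx, hy⟩ := exists_real_eigenpair hz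
  have hle : ∀ u, quad P (Fᵀ *ᵥ u) ≤ quad P u := by
    intro u
    by_cases hu : u = 0
    · simp [hu]
    · exact (h u hu).le
  have hP' := posDef_iff_quad.1 hP
  have hnn : ∀ u, 0 ≤ quad P u := (posSemidef_iff_quad.1 hP.posSemidef).2
  have hlt : quad P (Fᵀ *ᵥ x) + quad P (Fᵀ *ᵥ y) < quad P x + quad P y := by
    rcases hxy with h0 | h0
    · linarith [h x h0, hle y]
    · linarith [h y h0, hle x]
  -- On the real and imaginary parts of an eigenvector the cross terms cancel, leaving the factor
  -- `|z|²`.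
  have hsum : quad P (Fᵀ *ᵥ x) + quad P (Fᵀ *ᵥ y)
      = (z.re ^ 2 + z.im ^ 2) * (quad P x + quad P y) := by
    rw [hx, hy, sub_eq_add_neg, ← neg_smul, quad_add_smul_of_isSymm hP'.1,
      quad_add_smul_of_isSymm hP'.1,
      quad_smul, quad_smul, smul_dotProduct, smul_dotProduct, symm_dotProduct_mulVec hP'.1 y]
    simp only [smul_eq_mul]
    ring
  have hpos : 0 < quad P x + quad P y := by
    rcases hxy with h0 | h0
    · linarith [hP'.2 x h0, hnn y]
    · linarith [hP'.2 y h0, hnn x]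
  rw [hsum] at hlt
  have hz1 : z.re ^ 2 + z.im ^ 2 < 1 := by
    by_contra hcon
    nlinarith [mul_nonneg (sub_nonneg.2 (not_lt.1 hcon)) hpos.le]
  rw [Complex.norm_def, Real.sqrt_lt' one_pos, Complex.normSq_apply]
  linarith

theorem systemRow_transpose_mulVec (A : Matrix (Fin n) (Fin n) ℝ) (B : Matrix (Fin n) (Fin m) ℝ)
    (u : Fin n → ℝ) : (systemRow A B)ᵀ *ᵥ u = Sum.elim u ((fromCols A B)ᵀ *ᵥ u) := by
  rw [systemRow, transpose_fromCols 1, fromRows_mulVec, transpose_one, one_mulVec]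

theorem systemQMIMatrix_isSymm {E : Matrix (Fin n ⊕ (Fin n ⊕ Fin m)) (Fin p) ℝ}
    {Φ : Matrix (Fin p ⊕ Fin T) (Fin p ⊕ Fin T) ℝ} (hΦ : Φ.IsSymm)
    (Xp Xm : Matrix (Fin n) (Fin T) ℝ) (Um : Matrix (Fin m) (Fin T) ℝ) :
    (systemQMIMatrix E Φ Xp Xm Um).IsSymm := by
  rw [systemQMIMatrix, IsSymm, transpose_mul, transpose_mul, transpose_transpose, hΦ.eq,
    Matrix.mul_assoc]

theorem quad_systemQMIMatrix (E : Matrix (Fin n ⊕ (Fin n ⊕ Fin m)) (Fin p) ℝ)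
    (Φ : Matrix (Fin p ⊕ Fin T) (Fin p ⊕ Fin T) ℝ)
    (Xp Xm : Matrix (Fin n) (Fin T) ℝ) (Um : Matrix (Fin m) (Fin T) ℝ)
    (A : Matrix (Fin n) (Fin n) ℝ) (B : Matrix (Fin n) (Fin m) ℝ) (u : Fin n → ℝ) :
    quad (systemQMIMatrix E Φ Xp Xm Um) (Sum.elim u ((fromCols A B)ᵀ *ᵥ u))
      = quad Φ (Sum.elim ((systemRow A B * E)ᵀ *ᵥ u)
          ((systemRow A B * dataMatrix Xp Xm Um)ᵀ *ᵥ u)) := by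
  rw [← systemRow_transpose_mulVec, systemQMIMatrix, quad_conj', transpose_fromCols,
    fromRows_mulVec, mulVec_mulVec, mulVec_mulVec, transpose_mul, transpose_mul]

/-- Consistent systems satisfy the quadratic matrix inequality of the data. -/
theorem quad_nonneg_of_mem_consistentSystems
    {E : Matrix (Fin n ⊕ (Fin n ⊕ Fin m)) (Fin p) ℝ}
    {Φ : Matrix (Fin p ⊕ Fin T) (Fin p ⊕ Fin T) ℝ} (hΦ : Φ.IsSymm)
    {Xp Xm : Matrix (Fin n) (Fin T) ℝ} {Um : Matrix (Fin m) (Fin T) ℝ}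
    {A : Matrix (Fin n) (Fin n) ℝ} {B : Matrix (Fin n) (Fin m) ℝ}
    (hS : (A, B) ∈ consistentSystems E Φ Xp Xm Um) (u : Fin n → ℝ) :
    0 ≤ quad (systemQMIMatrix E Φ Xp Xm Um) (Sum.elim u ((fromCols A B)ᵀ *ᵥ u)) := by
  obtain ⟨D, hD, hS⟩ := hS
  simp only at hS
  rw [quad_systemQMIMatrix, hS, ← Matrix.mul_assoc, transpose_mul _ D, ← mulVec_mulVec]
  exact (satisfiesQMI_iff_quad hΦ _).1 hD _

/-- Since `[I A B] E₀ = I`, the inclusion of `im E₀` in `im E` makes `[I A B] E` onto, which is what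
noise recovery needs when `Φ₂₂` is singular. -/
theorem mem_consistentSystems_of_quad_nonneg
    {E : Matrix (Fin n ⊕ (Fin n ⊕ Fin m)) (Fin p) ℝ}
    {Φ : Matrix (Fin p ⊕ Fin T) (Fin p ⊕ Fin T) ℝ} (hΦ : IsEllipsoidMatrix Φ)
    {Xp Xm : Matrix (Fin n) (Fin T) ℝ} {Um : Matrix (Fin m) (Fin T) ℝ}
    (hE : (-Φ.toBlocks₂₂).PosDef ∨
      LinearMap.range (noiseEmbedding n m).mulVecLin ≤ LinearMap.range E.mulVecLin)
    {A : Matrix (Fin n) (Fin n) ℝ} {B : Matrix (Fin n) (Fin m) ℝ}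
    (h : ∀ u, 0 ≤ quad (systemQMIMatrix E Φ Xp Xm Um) (Sum.elim u ((fromCols A B)ᵀ *ᵥ u))) :
    (A, B) ∈ consistentSystems E Φ Xp Xm Um := by
  obtain ⟨D, hD, hY⟩ := hΦ.exists_satisfiesQMI (M := systemRow A B * E)
    (Y := systemRow A B * dataMatrix Xp Xm Um)
    (fun x => by rw [← quad_systemQMIMatrix]; exact h x)
    (hE.imp_right fun hE V => by
      have hcol : ∀ v : Fin n → ℝ, ∃ w, (systemRow A B * E) *ᵥ w = v := by
        intro v
        obtain ⟨w, hw⟩ := hE ⟨v, rfl⟩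
        refine ⟨w, ?_⟩
        rw [mulVecLin_apply, mulVecLin_apply] at hw
        rw [← mulVec_mulVec, hw, mulVec_mulVec, systemRow, noiseEmbedding, fromCols_mul_fromRows,
          Matrix.mul_one, Matrix.mul_zero, add_zero, one_mulVec]
      choose f hf using hcol
      refine ⟨(of fun j => f (Vᵀ j))ᵀ, ?_⟩
      ext i j
      exact congrFun (hf (Vᵀ j)) i)
  exact ⟨D, hD, by rw [hY, Matrix.mul_assoc]⟩

theorem mem_consistentSystems_of_data
    {E : Matrix (Fin n ⊕ (Fin n ⊕ Fin m)) (Fin p) ℝ}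
    {Φ : Matrix (Fin p ⊕ Fin T) (Fin p ⊕ Fin T) ℝ}
    {Xp Xm : Matrix (Fin n) (Fin T) ℝ} {Um : Matrix (Fin m) (Fin T) ℝ}
    {As : Matrix (Fin n) (Fin n) ℝ} {Bs : Matrix (Fin n) (Fin m) ℝ}
    {ΔZ ΔX : Matrix (Fin n) (Fin T) ℝ} {ΔU : Matrix (Fin m) (Fin T) ℝ}
    {hatΔ : Matrix (Fin p) (Fin T) ℝ}
    (hdata : Xp - ΔZ = As * (Xm - ΔX) + Bs * (Um - ΔU))
    (hΔ : fromRows ΔZ (fromRows (-ΔX) (-ΔU)) = E * hatΔ)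
    (hnoise : SatisfiesQMI Φ hatΔᵀ) : (As, Bs) ∈ consistentSystems E Φ Xp Xm Um := by
  refine ⟨hatΔ, hnoise, ?_⟩
  rw [← hΔ, systemRow, dataMatrix, fromCols_mul_fromRows, fromCols_mul_fromRows,
    fromCols_mul_fromRows, fromCols_mul_fromRows, Matrix.one_mul, Matrix.one_mul]
  rw [Matrix.mul_sub, Matrix.mul_sub] at hdata
  simp only [Matrix.mul_neg]
  have : Xp = ΔZ + (As * Xm - As * ΔX + (Bs * Um - Bs * ΔU)) := by rw [← hdata]; abel
  rw [this]
  abel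

/-- The term `L P⁻¹ Lᵀ = K P Kᵀ` fills the zero corner and completes the block to `-[I; K] P [I
Kᵀ]`. -/
theorem schur_lmi_eq {P : Matrix (Fin n) (Fin n) ℝ} (hP : P.PosDef)
    (K : Matrix (Fin m) (Fin n) ℝ) (β : ℝ) :
    fromBlocks (P - β • (1 : Matrix (Fin n) (Fin n) ℝ)) 0 0
        (fromBlocks (-P) (-(K * P)ᵀ) (-(K * P)) 0)
      - fromRows 0 (fromRows 0 (K * P)) * P⁻¹ * (fromRows 0 (fromRows 0 (K * P)))ᵀ
      = fromBlocks (P - β • (1 : Matrix (Fin n) (Fin n) ℝ)) 0 0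
        (-((gainRow K)ᵀ * P * gainRow K)) := by
  have hs := (posDef_iff_quad.1 hP).1.eq
  have hu : IsUnit P.det := (isUnit_iff_isUnit_det _).1 hP.isUnit
  have h1 : K * P * P⁻¹ * (P * Kᵀ) = K * P * Kᵀ := by
    rw [mul_nonsing_inv_cancel_right _ _ hu, Matrix.mul_assoc]
  simp only [transpose_fromRows, transpose_zero, fromRows_mul, gainRow,
    transpose_fromCols, transpose_one, transpose_transpose, Matrix.zero_mul, Matrix.mul_zero,
    Matrix.one_mul, Matrix.mul_one, transpose_mul, hs, h1, mul_fromCols]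
  ext (i | i | i) (j | j | j) <;> simp

theorem solvesLMI_iff_quad {N : Matrix (Fin n ⊕ (Fin n ⊕ Fin m)) (Fin n ⊕ (Fin n ⊕ Fin m)) ℝ}
    (hN : N.IsSymm) (P : Matrix (Fin n) (Fin n) ℝ) (K : Matrix (Fin m) (Fin n) ℝ) (β : ℝ) :
    SolvesLMI N P (K * P) β ↔ P.PosDef ∧ 0 < β ∧ ∀ u y,
      β * (u ⬝ᵥ u) ≤ quad P u - quad P (gainRow K *ᵥ y) - quad N (Sum.elim u y) := by
  rw [SolvesLMI]
  refine and_congr_right fun hP => and_congr_right fun _ => ?_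
  have hs := (posDef_iff_quad.1 hP).1
  let : Invertible P := hP.isUnit.invertible
  have hT : fromCols 0 (fromCols 0 (K * P)ᵀ)
      = (fromRows (0 : Matrix (Fin n) (Fin n) ℝ)
          (fromRows (0 : Matrix (Fin n) (Fin n) ℝ) (K * P)))ᴴ := by
    rw [conjTranspose_eq_transpose_of_trivial, transpose_fromRows, transpose_fromRows]
    rfl
  rw [sub_eq_add_neg, fromBlocks_neg, fromBlocks_add, neg_zero, add_zero, neg_zero, add_zero,
    neg_zero, add_zero, ← sub_eq_add_neg, hT, PosDef.fromBlocks₂₂ _ _ hP,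
    conjTranspose_eq_transpose_of_trivial, sub_right_comm, schur_lmi_eq hP]
  have hq : ∀ u y, quad (fromBlocks (P - β • (1 : Matrix (Fin n) (Fin n) ℝ)) 0 0
        (-((gainRow K)ᵀ * P * gainRow K)) - N) (Sum.elim u y)
      = quad P u - β * (u ⬝ᵥ u) - quad P (gainRow K *ᵥ y) - quad N (Sum.elim u y) := by
    intro u y
    have e : quad (fromBlocks (P - β • (1 : Matrix (Fin n) (Fin n) ℝ)) 0 0
          (-((gainRow K)ᵀ * P * gainRow K))) (Sum.elim u y)
        = quad (P - β • (1 : Matrix (Fin n) (Fin n) ℝ)) u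
          + quad (-((gainRow K)ᵀ * P * gainRow K)) y := by
      simp [quad, fromBlocks_mulVec, sumElim_dotProduct_sumElim]
    rw [quad_sub_matrix, e, quad_sub_matrix, quad_smul_matrix, quad_one, quad_neg_matrix,
      quad_conj]
    ring
  rw [posSemidef_iff_quad]
  constructor
  · rintro ⟨-, h⟩ u y
    have := h (Sum.elim u y)
    rw [hq] at this
    linarith
  · intro h
    refine ⟨?_, fun x => ?_⟩
    · rw [IsSymm, transpose_sub, hN.eq, fromBlocks_transpose]
      simp only [transpose_sub, transpose_neg, transpose_mul, transpose_transpose, hs.eq,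
        transpose_smul, transpose_one, transpose_zero, Matrix.mul_assoc]
    · rw [← Sum.elim_comp_inl_inr x, hq]
      linarith [h (x ∘ Sum.inl) (x ∘ Sum.inr)]

theorem stabilizes_of_solvesLMI
    {E : Matrix (Fin n ⊕ (Fin n ⊕ Fin m)) (Fin p) ℝ}
    {Φ : Matrix (Fin p ⊕ Fin T) (Fin p ⊕ Fin T) ℝ} (hΦ : Φ.IsSymm)
    {Xp Xm : Matrix (Fin n) (Fin T) ℝ} {Um : Matrix (Fin m) (Fin T) ℝ}
    {P : Matrix (Fin n) (Fin n) ℝ} {L : Matrix (Fin m) (Fin n) ℝ} {β : ℝ}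
    (h : SolvesLMI (systemQMIMatrix E Φ Xp Xm Um) P L β)
    {A : Matrix (Fin n) (Fin n) ℝ} {B : Matrix (Fin n) (Fin m) ℝ}
    (hS : (A, B) ∈ consistentSystems E Φ Xp Xm Um) :
    LyapunovInequality A B (L * P⁻¹) P ∧ IsSchurStable (A + B * (L * P⁻¹)) := by
  have hP := h.1
  have hL : L = L * P⁻¹ * P :=
    (nonsing_inv_mul_cancel_right _ _ ((isUnit_iff_isUnit_det _).1 hP.isUnit)).symm
  rw [hL, solvesLMI_iff_quad (systemQMIMatrix_isSymm hΦ Xp Xm Um)] at h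
  obtain ⟨-, hβ, h⟩ := h
  have hly : LyapunovInequality A B (L * P⁻¹) P := by
    rw [lyapunovInequality_iff_quad hP]
    intro u hu
    have h1 := h u ((fromCols A B)ᵀ *ᵥ u)
    have h2 := quad_nonneg_of_mem_consistentSystems hΦ hS u
    have h3 := mul_pos hβ (dotProduct_self_pos hu)
    linarith
  refine ⟨hly, isSchurStable_of_quad_lt hP fun u hu => ?_⟩
  have := (lyapunovInequality_iff_quad hP A B _).1 hly u hu
  rwa [gainRow_mulVec_transpose] at this

theorem exists_solvesLMI_of_informative (hn : 1 ≤ n)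
    {E : Matrix (Fin n ⊕ (Fin n ⊕ Fin m)) (Fin p) ℝ}
    {Φ : Matrix (Fin p ⊕ Fin T) (Fin p ⊕ Fin T) ℝ} (hΦ : IsEllipsoidMatrix Φ)
    {Xp Xm : Matrix (Fin n) (Fin T) ℝ} {Um : Matrix (Fin m) (Fin T) ℝ}
    (hE : (-Φ.toBlocks₂₂).PosDef ∨
      LinearMap.range (noiseEmbedding n m).mulVecLin ≤ LinearMap.range E.mulVecLin)
    (hne : (consistentSystems E Φ Xp Xm Um).Nonempty)
    (h : InformativeForQuadraticStabilization E Φ Xp Xm Um) :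
    ∃ P L β, SolvesLMI (systemQMIMatrix E Φ Xp Xm Um) P L β := by
  obtain ⟨K, P, hP, hK⟩ := h
  obtain ⟨⟨A₀, B₀⟩, h₀⟩ := hne
  have : Nonempty (Fin n) := ⟨⟨0, hn⟩⟩
  have hN := systemQMIMatrix_isSymm (E := E) hΦ.symm Xp Xm Um
  have hQ : ∀ Z : Matrix (Fin n ⊕ Fin m) (Fin n) ℝ,
      (∀ u, 0 ≤ quad (systemQMIMatrix E Φ Xp Xm Um) (Sum.elim u (Z *ᵥ u))) →
      ∀ u, u ≠ 0 → quad P (gainRow K *ᵥ (Z *ᵥ u)) < quad P u := by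
    intro Z hZ
    obtain ⟨A, B, rfl⟩ : ∃ A B, Z = (fromCols A B)ᵀ :=
      ⟨Z.toRows₁ᵀ, Z.toRows₂ᵀ, by
        rw [transpose_fromCols, transpose_transpose, transpose_transpose, fromRows_toRows]⟩
    exact (lyapunovInequality_iff_quad hP A B K).1
      (hK (A, B) (mem_consistentSystems_of_quad_nonneg hΦ hE hZ))
  obtain ⟨α, β, hα, hβ, hαβ⟩ := exists_matrix_multiplier hN hP (gainRow_surjective K)
    (quad_nonneg_of_mem_consistentSystems hΦ.symm h₀) hQ
  have hα' := inv_pos.2 hα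
  -- The LMI has multiplier one; dividing by `α` rescales `P` and `β` but keeps the gain `K`.
  refine ⟨α⁻¹ • P, K * (α⁻¹ • P), α⁻¹ * β, (solvesLMI_iff_quad hN _ _ _).2
    ⟨hP.smul hα', mul_pos hα' hβ, fun u y => ?_⟩⟩
  have := mul_le_mul_of_nonneg_left (hαβ u y) hα'.le
  rw [quad_smul_matrix, quad_smul_matrix]
  calc α⁻¹ * β * (u ⬝ᵥ u) = α⁻¹ * (β * (u ⬝ᵥ u)) := mul_assoc _ _ _
    _ ≤ _ := this
    _ = _ := by
      rw [mul_sub, mul_sub, ← mul_assoc α⁻¹ α, inv_mul_cancel₀ hα.ne', one_mul]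

end Systems

end

theorem theorem3 {n m p T : ℕ} (hn : 1 ≤ n)
    (E : Matrix (Fin n ⊕ (Fin n ⊕ Fin m)) (Fin p) ℝ)
    (Φ : Matrix (Fin p ⊕ Fin T) (Fin p ⊕ Fin T) ℝ) (hΦ : IsEllipsoidMatrix Φ)
    (Xp Xm : Matrix (Fin n) (Fin T) ℝ) (Um : Matrix (Fin m) (Fin T) ℝ)
    (As : Matrix (Fin n) (Fin n) ℝ) (Bs : Matrix (Fin n) (Fin m) ℝ)
    (ΔZ ΔX : Matrix (Fin n) (Fin T) ℝ) (ΔU : Matrix (Fin m) (Fin T) ℝ)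
    (hatΔ : Matrix (Fin p) (Fin T) ℝ)
    (hdata : Xp - ΔZ = As * (Xm - ΔX) + Bs * (Um - ΔU))
    (hΔ : Matrix.fromRows ΔZ (Matrix.fromRows (-ΔX) (-ΔU)) = E * hatΔ)
    (hnoise : SatisfiesQMI Φ hatΔ.transpose) :
    ((∃ P L β, SolvesLMI (systemQMIMatrix E Φ Xp Xm Um) P L β) →
      InformativeForQuadraticStabilization E Φ Xp Xm Um) ∧
    (((-Φ.toBlocks₂₂).PosDef ∨
        LinearMap.range (noiseEmbedding n m).mulVecLin ≤ LinearMap.range E.mulVecLin) →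
      (InformativeForQuadraticStabilization E Φ Xp Xm Um ↔
        ∃ P L β, SolvesLMI (systemQMIMatrix E Φ Xp Xm Um) P L β)) ∧
    (∀ P L β, SolvesLMI (systemQMIMatrix E Φ Xp Xm Um) P L β →
      ∀ S ∈ consistentSystems E Φ Xp Xm Um,
        LyapunovInequality S.1 S.2 (L * P⁻¹) P ∧ IsSchurStable (S.1 + S.2 * (L * P⁻¹))) := by
  have hsol : ∀ P L β, SolvesLMI (systemQMIMatrix E Φ Xp Xm Um) P L β →
      ∀ S ∈ consistentSystems E Φ Xp Xm Um,
        LyapunovInequality S.1 S.2 (L * P⁻¹) P ∧ IsSchurStable (S.1 + S.2 * (L * P⁻¹)) :=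
    fun P L β h S hS => stabilizes_of_solvesLMI hΦ.symm h (A := S.1) (B := S.2) hS
  have hsuff : (∃ P L β, SolvesLMI (systemQMIMatrix E Φ Xp Xm Um) P L β) →
      InformativeForQuadraticStabilization E Φ Xp Xm Um := by
    rintro ⟨P, L, β, h⟩
    exact ⟨L * P⁻¹, P, h.1, fun S hS => (hsol P L β h S hS).1⟩
  exact ⟨hsuff, fun hE => ⟨exists_solvesLMI_of_informative hn hΦ hE
    ⟨(As, Bs), mem_consistentSystems_of_data hdata hΔ hnoise⟩, hsuff⟩, hsol⟩
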